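/- Let $2\le k<n$, let $\Omega\subset\mathbb{R}^n$ be open, and let $V$ be a distribution of $k$-planes on $\Omega$ spanned by vectorfields $v_1,\dots,v_k$ of class $C^1$ on $\Omega$; set $v:=v_1\wedge\dots\wedge v_k$. For a $2$-vectorfield $w$ of class $C^1$ set $\operatorname{div}w:=\sum_{j=1}^n\frac{\partial w}{\partial x_j}\llcorner dx_j$, where $a\llcorner\alpha$ is defined by $\langle a\llcorner\alpha,\beta\rangle=\langle a,\alpha\wedge\beta\rangle$. The span of an $h$-vector $a$ is the smallest linear subspace $W$ of $\mathbb{R}^n$ with $a\in\Lambda_h(W)$; an $h$-vectorfield $w$ is tangent to $V$ if $\operatorname{span}(w(x))\subset V(x)$ for every $x\in\Omega$, and a current $T=\tau\nu$ is tangent to $V$ if $\operatorname{span}(\tau(x))\subset V(x)$ for $\nu$-a.e. $x$. The boundary of a current is defined by $\langle\partial T,\omega\rangle=\langle T,d\omega\rangle$. Let $T$ be a normal $k$-current on $\Omega$ which is tangent to $V$, written as $T=v\mu$ with $\mu$ a locally finite signed Borel measure on $\Omega$ and $v\in L^1(|\mu|)$, and write $\partial T=\tau'\mu'$ with $\mu'$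 a locally finite positive Borel measure on $\Omega$ and $\tau'\in L^1(\mu')$ a $(k-1)$-vectorfield with $\tau'\ne 0$ $\mu'$-a.e. Let $w$ be any $2$-vectorfield of class $C^1$ on $\Omega$ which is tangent to $V$. Then $$(\tau'\wedge w)\,\mu'=(-1)^{k-1}\,(v\wedge\operatorname{div}w)\,\mu$$ as locally finite measures on $\Omega$ with values in $(k+1)$-vectors; that is, for every Borel set $B$ contained in a compact subset of $\Omega$ both densities are integrable on $B$ and $\int_B\tau'\wedge w\,d\mu'=(-1)^{k-1}\int_B v\wedge\operatorname{div}w\,d\mu$. -/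

import Mathlib

open MeasureTheory Set TopologicalSpace
open scoped Distributions

noncomputable section

namespace NormalCurrent

/-! ### Multivectors in `ℝⁿ` -/

/-- The Euclidean space `ℝⁿ`. -/
abbrev E (n : ℕ) : Type := EuclideanSpace ℝ (Fin n)

/-- The space `Λ_k(ℝⁿ)` of `k`-vectors in `ℝⁿ`. -/
abbrev MultiVec (n k : ℕ) : Type := ⋀[ℝ]^k (E n)

/-- The canonical basis `(e_i)`, `i ∈ I(n,k)`, of `Λ_k(ℝⁿ)`. -/
def stdBasis (n k : ℕ) : Module.Basis (Set.powersetCard (Fin n) k) ℝ (MultiVec n k) :=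
  (EuclideanSpace.basisFun (Fin n) ℝ).toBasis.exteriorPower k

/-- The coordinates of a `k`-vector with respect to the canonical basis. -/
def coords (n k : ℕ) :
    MultiVec n k ≃ₗ[ℝ] EuclideanSpace ℝ (Set.powersetCard (Fin n) k) :=
  (stdBasis n k).equivFun.trans (WithLp.linearEquiv 2 ℝ _).symm

/-- `Λ_k(ℝⁿ)` carries the Euclidean norm associated to the canonical basis. -/
instance instNormedAddCommGroup (n k : ℕ) : NormedAddCommGroup (MultiVec n k) :=
  NormedAddCommGroup.induced _ _ (coords n k) (coords n k).injective

instance instNormedSpace (n k : ℕ) : NormedSpace ℝ (MultiVec n k) :=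
  NormedSpace.induced ℝ (MultiVec n k) (EuclideanSpace ℝ (Set.powersetCard (Fin n) k))
    (coords n k).toLinearMap

/-- The space `Λ^k(ℝⁿ)` of `k`-covectors on `ℝⁿ`. -/
abbrev Covec (n k : ℕ) : Type := (E n) [⋀^Fin k]→L[ℝ] ℝ

/-- The duality pairing `⟨a, α⟩`, characterised by
`⟨a₁ ∧ ⋯ ∧ a_k, α⟩ = α (a₁, …, a_k)`. -/
def pairing {n k : ℕ} (a : MultiVec n k) (α : Covec n k) : ℝ :=
  exteriorPower.alternatingMapLinearEquiv α.toAlternatingMap a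

/-- The Euclidean norm on `Λ^k(ℝⁿ)` associated to the canonical basis `(dx_i)`: the coordinate of
`α` along `dx_i` is `⟨e_i, α⟩`. -/
def covecNorm {n k : ℕ} (α : Covec n k) : ℝ :=
  Real.sqrt (∑ s : Set.powersetCard (Fin n) k, pairing (stdBasis n k s) α ^ 2)

/-- The exterior product of multivectors. -/
def wedge {n k l : ℕ} (a : MultiVec n k) (b : MultiVec n l) : MultiVec n (k + l) :=
  ⟨(a : ExteriorAlgebra ℝ (E n)) * (b : ExteriorAlgebra ℝ (E n)),
    SetLike.GradedMul.mul_mem a.2 b.2⟩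

/-- Contraction with a covector lowers the degree by one. -/
theorem contractLeft_mem {n : ℕ} (α : Module.Dual ℝ (E n)) (k : ℕ)
    (a : ExteriorAlgebra ℝ (E n)) (ha : a ∈ ⋀[ℝ]^(k + 1) (E n)) :
    CliffordAlgebra.contractLeft (Q := (0 : QuadraticForm ℝ (E n))) α a ∈ ⋀[ℝ]^k (E n) := by
  induction k generalizing a with
  | zero =>
    rw [zero_add, ExteriorAlgebra.exteriorPower, pow_one] at ha
    obtain ⟨x, rfl⟩ := ha
    have h := CliffordAlgebra.contractLeft_ι (Q := (0 : QuadraticForm ℝ (E n))) α x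
    rw [ExteriorAlgebra.exteriorPower, pow_zero]
    exact h ▸ Submodule.algebraMap_mem _
  | succ k ih =>
    rw [ExteriorAlgebra.exteriorPower, pow_succ'] at ha
    refine Submodule.mul_induction_on ha ?_ ?_
    · rintro _ ⟨x, rfl⟩ b hb
      have h := CliffordAlgebra.contractLeft_ι_mul (Q := (0 : QuadraticForm ℝ (E n)))
        (d := α) x b
      refine h ▸ Submodule.sub_mem _ (Submodule.smul_mem _ _ hb) ?_
      rw [ExteriorAlgebra.exteriorPower, pow_succ']
      exact Submodule.mul_mem_mul ⟨x, rfl⟩ (ih b hb)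
    · intro x y hx hy
      rw [map_add]
      exact Submodule.add_mem _ hx hy

/-- The interior product `a ⌞ α` of a `(k+1)`-vector `a` and a `1`-covector `α`, that is, the
`k`-vector with `⟨a ⌞ α, β⟩ = ⟨a, α ∧ β⟩` for every `k`-covector `β`.  Equivalently
`(a₀ ∧ b) ⌞ α = ⟨a₀, α⟩ b - a₀ ∧ (b ⌞ α)` for a vector `a₀`. -/
def interiorProd {n k : ℕ} (a : MultiVec n (k + 1)) (α : Module.Dual ℝ (E n)) : MultiVec n k :=
  ⟨CliffordAlgebra.contractLeft (Q := (0 : QuadraticForm ℝ (E n))) α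
      (a : ExteriorAlgebra ℝ (E n)),
    contractLeft_mem α k a a.2⟩

/-- The span of a `k`-vector `a`: the smallest linear subspace `W` with `a ∈ Λ_k(W)`, where
`Λ_k(W)` is identified with a subspace of `Λ_k(ℝⁿ)` through the inclusion of `W`. -/
def mspan {n k : ℕ} (a : MultiVec n k) : Submodule ℝ (E n) :=
  sInf {W | a ∈ LinearMap.range (exteriorPower.map k W.subtype)}

/-- The divergence of a `(k+1)`-vectorfield: `div w = ∑ⱼ (∂w/∂xⱼ) ⌞ dxⱼ`. -/
def divergence {n k : ℕ} (w : E n → MultiVec n (k + 1)) (x : E n) : MultiVec n k :=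
  ∑ j : Fin n, interiorProd (fderiv ℝ w x (EuclideanSpace.single j 1))
    (EuclideanSpace.proj j : E n →L[ℝ] ℝ).toLinearMap

/-! ### Distributions of planes -/

/-- `V` is a distribution of `k`-planes on `Ω`. -/
def IsPlaneDistribution {n : ℕ} {Ω : Opens (E n)} (k : ℕ) (V : Ω → Submodule ℝ (E n)) : Prop :=
  ∀ x, Module.finrank ℝ (V x) = k

/-- The vectorfields `u₁, …, u_k` span `V` at every point of `Ω`. -/
def Spans {n k : ℕ} {Ω : Opens (E n)} (u : Fin k → E n → E n) (V : Ω → Submodule ℝ (E n)) :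
    Prop :=
  ∀ x : Ω, V x = Submodule.span ℝ (range fun i => u i x)

/-- The simple `k`-vectorfield `u₁ ∧ ⋯ ∧ u_k`. -/
def simpleField {n k : ℕ} (u : Fin k → E n → E n) (x : E n) : MultiVec n k :=
  exteriorPower.ιMulti ℝ k fun i => u i x

/-- The `h`-vectorfield `w` is tangent to `V` on `Ω`. -/
def IsTangentField {n h : ℕ} {Ω : Opens (E n)} (w : E n → MultiVec n h)
    (V : Ω → Submodule ℝ (E n)) : Prop :=
  ∀ x : Ω, mspan (w x) ≤ V x

/-! ### Currents -/

/-- A `k`-current on `Ω`: a continuous linear functional on the space of smooth `k`-forms with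
compact support in `Ω`. -/
abbrev Current {n : ℕ} (Ω : Opens (E n)) (k : ℕ) : Type := 𝓓(Ω, Covec n k) →L[ℝ] ℝ

/-- The exterior derivative on smooth compactly supported forms. -/
def extDerivTest {n : ℕ} (Ω : Opens (E n)) (k : ℕ) :
    𝓓(Ω, Covec n k) →L[ℝ] 𝓓(Ω, Covec n (k + 1)) :=
  (TestFunction.postcompCLM
      (ContinuousAlternatingMap.alternatizeUncurryFinCLM ℝ (E n) ℝ)).comp
    (TestFunction.fderivCLM ℝ ⊤ ⊤)

/-- On test forms, `extDerivTest` is the usual exterior derivative. -/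
theorem extDerivTest_apply {n k : ℕ} {Ω : Opens (E n)} (ω : 𝓓(Ω, Covec n k)) (x : E n) :
    extDerivTest Ω k ω x = extDeriv (fun y => ω y) x := by
  simp [extDerivTest, extDeriv, TestFunction.fderivCLM_apply]

/-- The boundary of a current: `⟨∂T, ω⟩ = ⟨T, dω⟩`. -/
def boundary {n k : ℕ} {Ω : Opens (E n)} (T : Current Ω (k + 1)) : Current Ω k :=
  T.comp (extDerivTest Ω k)

/-- The mass of a current. -/
def mass {n k : ℕ} {Ω : Opens (E n)} (T : Current Ω k) : ENNReal :=
  ⨆ (ω : 𝓓(Ω, Covec n k)) (_ : ∀ x, covecNorm (ω x) ≤ 1), ENNReal.ofReal (T ω)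

/-- A current is normal if it and its boundary have finite mass. -/
def IsNormal {n k : ℕ} {Ω : Opens (E n)} (T : Current Ω (k + 1)) : Prop :=
  mass T < ⊤ ∧ mass (boundary T) < ⊤

/-- A locally finite signed Borel measure, given by its Jordan decomposition
`μ = μ⁺ - μ⁻`. -/
structure SignedRadon (X : Type*) [TopologicalSpace X] [MeasurableSpace X] where
  /-- The positive part. -/
  pos : Measure X
  /-- The negative part. -/
  neg : Measure X
  locallyFinite_pos : IsLocallyFiniteMeasure pos
  locallyFinite_neg : IsLocallyFiniteMeasure neg
  mutuallySingular : pos ⟂ₘ neg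

/-- The variation measure `|μ| = μ⁺ + μ⁻`. -/
def SignedRadon.variation {X : Type*} [TopologicalSpace X] [MeasurableSpace X]
    (μ : SignedRadon X) : Measure X :=
  μ.pos + μ.neg

/-- The integral `∫_B f dμ` with respect to a signed measure, for `f` integrable on `B` with
respect to `|μ|`. -/
def SignedRadon.setIntegral {X F : Type*} [TopologicalSpace X] [MeasurableSpace X]
    [NormedAddCommGroup F] [NormedSpace ℝ F] (μ : SignedRadon X) (B : Set X) (f : X → F) : F :=
  (∫ x in B, f x ∂μ.pos) - ∫ x in B, f x ∂μ.neg

/-- `T = τμ` with `μ` a (locally finite) positive measure on `Ω`, `τ ∈ L¹(μ)`, and `τ ≠ 0` almost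
everywhere. -/
def IsRepresented {n k : ℕ} {Ω : Opens (E n)} (T : Current Ω k) (τ : Ω → MultiVec n k)
    (μ : Measure Ω) : Prop :=
  IsLocallyFiniteMeasure μ ∧ Integrable τ μ ∧ (∀ᵐ x ∂μ, τ x ≠ 0) ∧
    ∀ ω : 𝓓(Ω, Covec n k), T ω = ∫ x : Ω, pairing (τ x) (ω x) ∂μ

/-- `T = τμ` with `μ` a (locally finite) signed measure on `Ω`, `τ ∈ L¹(|μ|)`, and `τ ≠ 0` almost
everywhere. -/
def IsRepresentedSigned {n k : ℕ} {Ω : Opens (E n)} (T : Current Ω k) (τ : Ω → MultiVec n k)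
    (μ : SignedRadon Ω) : Prop :=
  Integrable τ μ.variation ∧ (∀ᵐ x ∂μ.variation, τ x ≠ 0) ∧
    ∀ ω : 𝓓(Ω, Covec n k), T ω = μ.setIntegral univ fun x : Ω => pairing (τ x) (ω x)

/-- The current `T` has finite mass and is tangent to `V`: writing `T = τμ`, one has
`span(τ(x)) ⊆ V(x)` for `μ`-almost every `x`. -/
def IsTangentCurrent {n k : ℕ} {Ω : Opens (E n)} (T : Current Ω k)
    (V : Ω → Submodule ℝ (E n)) : Prop :=
  ∃ (τ : Ω → MultiVec n k) (μ : Measure Ω), IsRepresented T τ μ ∧ ∀ᵐ x ∂μ, mspan (τ x) ≤ V x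

end NormalCurrent

end

open NormalCurrent

noncomputable section

namespace NormalCurrent

/-! ### Contractions and wedge products -/

section Algebra

variable {n : ℕ}

/-! The identity comes from testing `∂T` on a form built from `w`. Given a test function `φ` and a
linear functional `ℓ` on `(k+1)`-vectors, let `η` be the `(k-1)`-form `a ↦ ℓ(a ∧ φw)`
(`wedgeCovec`). Then `⟨∂T, η⟩` is `ℓ` of the integral of `φ τ' ∧ w` against `μ'`, and it equals `⟨T,
dη⟩`. As `η` is only `C¹`, this last equality is obtained by mollification
(`integral_pairing_boundary`).

It remains to compute `⟨v, dη⟩ = ∑ⱼ ℓ((v ⌞ dxⱼ) ∧ ∂ⱼ(φw))`. Contracting `v ∧ ∂ⱼ(φw)` with `dxⱼ` by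
the Leibniz rule turns this into `(-1)^(k-1) ℓ(v ∧ div(φw))`, provided `v ∧ ∂ⱼ(φw) = 0`; and
`div(φw)` may be replaced by `φ div w`, since the extra term `w ⌞ dφ` takes values in `V` and is
killed by `v`.

The crux is `wedge_simpleField_fderiv_eq_zero`: `v` annihilates the first derivatives of a tangent
2-vectorfield. The field `w` is quadratic in directions of `V`, so a derivative leaves at least one
factor in `V`. This is made precise by differentiating `v ∧ (w ⌞ α) = 0` for constant `α` and
rebuilding the derivative from its contractions by Euler's identity (`sum_ι_mul_contractLeft`).

Finally, `setIntegral_eq_of_integral_testFunction_smul` passes from test functions to Borel sets. -/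

instance instFiniteDimensionalMultiVec (n k : ℕ) : FiniteDimensional ℝ (MultiVec n k) :=
  Module.Basis.finiteDimensional_of_finite (stdBasis n k)

/-- Contraction of a product whose left factor is simple. -/
theorem contractLeft_ιMulti_mul (α : Module.Dual ℝ (E n)) {k : ℕ} (a : Fin k → E n)
    (b : ExteriorAlgebra ℝ (E n)) :
    CliffordAlgebra.contractLeft (Q := (0 : QuadraticForm ℝ (E n))) α
        (ExteriorAlgebra.ιMulti ℝ k a * b) =
      CliffordAlgebra.contractLeft (Q := (0 : QuadraticForm ℝ (E n))) α
        (ExteriorAlgebra.ιMulti ℝ k a) * b +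
      (-1 : ℝ) ^ k • (ExteriorAlgebra.ιMulti ℝ k a *
        CliffordAlgebra.contractLeft (Q := (0 : QuadraticForm ℝ (E n))) α b) := by
  induction k generalizing b with
  | zero =>
    have h := CliffordAlgebra.contractLeft_one (Q := (0 : QuadraticForm ℝ (E n))) α
    simp only [ExteriorAlgebra.ιMulti_zero_apply, one_mul, pow_zero, one_smul]
    erw [h]
    simp
  | succ k ih =>
    have h1 := fun b => CliffordAlgebra.contractLeft_ι_mul (Q := (0 : QuadraticForm ℝ (E n)))
      (d := α) (a 0) b
    rw [ExteriorAlgebra.ιMulti_succ_apply, mul_assoc]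
    erw [h1, h1, ih]
    rw [sub_mul, mul_add, smul_mul_assoc, mul_assoc, mul_smul_comm, pow_succ]
    erw [← mul_assoc (ExteriorAlgebra.ι ℝ (a 0)) (ExteriorAlgebra.ιMulti ℝ k (Matrix.vecTail a))]
    simp only [mul_neg, mul_one, neg_smul, sub_eq_add_neg, neg_add, add_assoc]

/-- Expansion of the contraction of a simple multivector. -/
theorem contractLeft_ιMulti (α : Module.Dual ℝ (E n)) {k : ℕ} (a : Fin (k + 1) → E n) :
    CliffordAlgebra.contractLeft (Q := (0 : QuadraticForm ℝ (E n))) α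
        (ExteriorAlgebra.ιMulti ℝ (k + 1) a) =
      ∑ i : Fin (k + 1), ((-1 : ℝ) ^ (i : ℕ) * α (a i)) •
        ExteriorAlgebra.ιMulti ℝ k (i.removeNth a) := by
  induction k with
  | zero =>
    have h1 := CliffordAlgebra.contractLeft_ι (Q := (0 : QuadraticForm ℝ (E n))) α (a 0)
    rw [ExteriorAlgebra.ιMulti_succ_apply, ExteriorAlgebra.ιMulti_zero_apply, mul_one]
    erw [h1]
    simp [Algebra.algebraMap_eq_smul_one]
  | succ k ih =>
    have h1 := fun b => CliffordAlgebra.contractLeft_ι_mul (Q := (0 : QuadraticForm ℝ (E n)))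
      (d := α) (a 0) b
    rw [ExteriorAlgebra.ιMulti_succ_apply, Fin.sum_univ_succ]
    erw [h1, ih]
    rw [Finset.mul_sum, sub_eq_add_neg, ← Finset.sum_neg_distrib]
    congr 1
    · simp [Fin.removeNth_zero]
      rfl
    · refine Finset.sum_congr rfl fun i _ => ?_
      rw [ExteriorAlgebra.ιMulti_succ_apply (i.succ.removeNth a)]
      erw [mul_smul_comm]
      have ht : Matrix.vecTail (i.succ.removeNth a) = i.removeNth (Matrix.vecTail a) := by
        funext j
        simp [Matrix.vecTail, Fin.removeNth]
      have h0 : i.succ.removeNth a 0 = a 0 := by simp [Fin.removeNth]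
      rw [ht, h0]
      simp only [Fin.val_succ, pow_succ, mul_neg, mul_one, neg_mul, neg_smul]
      rfl

@[simp]
theorem coe_wedge {k l : ℕ} (a : MultiVec n k) (b : MultiVec n l) :
    (wedge a b : ExteriorAlgebra ℝ (E n)) = a * b := rfl

@[simp]
theorem coe_interiorProd {k : ℕ} (a : MultiVec n (k + 1)) (α : Module.Dual ℝ (E n)) :
    (interiorProd a α : ExteriorAlgebra ℝ (E n)) =
      CliffordAlgebra.contractLeft (Q := (0 : QuadraticForm ℝ (E n))) α
        (a : ExteriorAlgebra ℝ (E n)) := rfl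

/-- The wedge product as a bilinear map. -/
def wedgeₗ (n k l : ℕ) : MultiVec n k →ₗ[ℝ] MultiVec n l →ₗ[ℝ] MultiVec n (k + l) :=
  LinearMap.mk₂ ℝ wedge
    (fun a a' b => Subtype.ext (by simp [add_mul])) (fun c a b => Subtype.ext (by simp))
    (fun a b b' => Subtype.ext (by simp [mul_add])) (fun c a b => Subtype.ext (by simp))

@[simp]
theorem wedgeₗ_apply {k l : ℕ} (a : MultiVec n k) (b : MultiVec n l) :
    wedgeₗ n k l a b = wedge a b := rfl

/-- The interior product as a bilinear map. -/
def interiorProdₗ (n k : ℕ) :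
    Module.Dual ℝ (E n) →ₗ[ℝ] MultiVec n (k + 1) →ₗ[ℝ] MultiVec n k :=
  LinearMap.mk₂ ℝ (fun α a => interiorProd a α)
    (fun a a' b => Subtype.ext (by simp)) (fun c a b => Subtype.ext (by simp))
    (fun a b b' => Subtype.ext (by simp)) (fun c a b => Subtype.ext (by simp))

@[simp]
theorem interiorProdₗ_apply {k : ℕ} (a : MultiVec n (k + 1)) (α : Module.Dual ℝ (E n)) :
    interiorProdₗ n k α a = interiorProd a α := rfl

/-- Leibniz rule for the contraction of a wedge product of a simple `(k+1)`-vector with an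
`(l+1)`-vector. -/
theorem coe_wedge_interiorProd {k l : ℕ} (a : Fin (k + 1) → E n) (b : MultiVec n (l + 1))
    (α : Module.Dual ℝ (E n)) :
    CliffordAlgebra.contractLeft (Q := (0 : QuadraticForm ℝ (E n))) α
        (wedge (exteriorPower.ιMulti ℝ (k + 1) a) b : ExteriorAlgebra ℝ (E n)) =
      (wedge (interiorProd (exteriorPower.ιMulti ℝ (k + 1) a) α) b : ExteriorAlgebra ℝ (E n)) +
      (-1 : ℝ) ^ (k + 1) •
        (wedge (exteriorPower.ιMulti ℝ (k + 1) a) (interiorProd b α) :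
          ExteriorAlgebra ℝ (E n)) :=
  contractLeft_ιMulti_mul α a b

/-- A simple multivector is annihilated by the vectors in the span of its factors. -/
theorem ιMulti_mul_ι_eq_zero {k : ℕ} (a : Fin k → E n) {e : E n}
    (he : e ∈ Submodule.span ℝ (range a)) :
    ExteriorAlgebra.ιMulti ℝ k a * ExteriorAlgebra.ι ℝ e = 0 := by
  induction he using Submodule.span_induction with
  | mem x hx =>
    obtain ⟨i, rfl⟩ := hx
    induction k with
    | zero => exact i.elim0
    | succ k ih =>
      rw [ExteriorAlgebra.ιMulti_succ_apply, mul_assoc]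
      refine Fin.cases ?_ (fun j => ?_) i
      -- The left `x` anticommutes past the factors of `b` one at a time until it meets the right
      -- `x`, where the square vanishes.
      · have key : ∀ (l : ℕ) (b : Fin l → E n) (x : E n),
            ExteriorAlgebra.ι ℝ x * (ExteriorAlgebra.ιMulti ℝ l b * ExteriorAlgebra.ι ℝ x) =
              0 := by
          intro l
          induction l with
          | zero => intro b x; simp
          | succ l ihl =>
            intro b x
            have hs := ExteriorAlgebra.ι_add_mul_swap (R := ℝ) x (b 0)
            rw [ExteriorAlgebra.ιMulti_succ_apply, mul_assoc, ← mul_assoc,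
              eq_neg_of_add_eq_zero_left hs, neg_mul, mul_assoc, ihl, mul_zero, neg_zero]
        exact key _ _ _
      · have := ih (Matrix.vecTail a) j
        rw [show a j.succ = Matrix.vecTail a j from rfl, this, mul_zero]
  | zero => simp
  | add x y _ _ hx hy => simp [mul_add, hx, hy]
  | smul c x _ hx => simp [hx]

/-- If `a` lies in the exterior square of `W`, then its contractions lie in `W`. -/
theorem contractLeft_mem_of_mem_range {W : Submodule ℝ (E n)} {a : MultiVec n 2}
    (ha : a ∈ LinearMap.range (exteriorPower.map 2 W.subtype)) (α : Module.Dual ℝ (E n)) :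
    ∃ e ∈ W, CliffordAlgebra.contractLeft (Q := (0 : QuadraticForm ℝ (E n))) α
      (a : ExteriorAlgebra ℝ (E n)) = ExteriorAlgebra.ι ℝ e := by
  obtain ⟨b, rfl⟩ := ha
  have hb : b ∈ Submodule.span ℝ (range (exteriorPower.ιMulti ℝ 2 (M := W))) := by
    rw [exteriorPower.ιMulti_span]; trivial
  induction hb using Submodule.span_induction with
  | mem x hx =>
    obtain ⟨y, rfl⟩ := hx
    refine ⟨α (y 0) • (y 1 : E n) - α (y 1) • (y 0 : E n), by
      exact W.sub_mem (W.smul_mem _ (y 1).2) (W.smul_mem _ (y 0).2), ?_⟩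
    rw [exteriorPower.map_apply_ιMulti, exteriorPower.ιMulti_apply_coe, contractLeft_ιMulti]
    simp [Fin.sum_univ_two, ExteriorAlgebra.ιMulti_succ_apply, Fin.removeNth, sub_eq_add_neg,
      Matrix.vecTail]
  | zero => exact ⟨0, W.zero_mem, by simp⟩
  | add x y _ _ hx hy =>
    obtain ⟨e, he, h⟩ := hx
    obtain ⟨f, hf, h'⟩ := hy
    exact ⟨e + f, W.add_mem he hf, by simp [h, h']⟩
  | smul c x _ hx =>
    obtain ⟨e, he, h⟩ := hx
    exact ⟨c • e, W.smul_mem c he, by simp [h]⟩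

/-- The contractions of a `2`-vector lie in its span. -/
theorem contractLeft_mem_mspan (a : MultiVec n 2) (α : Module.Dual ℝ (E n)) :
    ∃ e ∈ mspan a, CliffordAlgebra.contractLeft (Q := (0 : QuadraticForm ℝ (E n))) α
      (a : ExteriorAlgebra ℝ (E n)) = ExteriorAlgebra.ι ℝ e := by
  -- The vector `e` is produced once from the whole space; injectivity of `ι` then places this same
  -- `e` in every `W` of the infimum. Membership of `a` in the exterior square of `mspan a` itself
  -- is not needed.
  have htop : a ∈ LinearMap.range (exteriorPower.map 2 (⊤ : Submodule ℝ (E n)).subtype) := by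
    rw [LinearMap.range_eq_top.2 (exteriorPower.map_surjective fun x => ⟨⟨x, trivial⟩, rfl⟩)]
    trivial
  obtain ⟨e, -, he⟩ := contractLeft_mem_of_mem_range htop α
  refine ⟨e, ?_, he⟩
  rw [mspan, Submodule.mem_sInf]
  intro W hW
  obtain ⟨f, hf, hf'⟩ := contractLeft_mem_of_mem_range hW α
  rwa [(ExteriorAlgebra.ι_inj ℝ e f).1 (he.symm.trans hf')]

/-- A contraction of a `2`-vector with a covector vanishing on its span is zero. -/
theorem contractLeft_eq_zero_of_mspan_le {V : Submodule ℝ (E n)} {a : MultiVec n 2}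
    (ha : mspan a ≤ V) (α : Module.Dual ℝ (E n)) (hα : ∀ x ∈ V, α x = 0) :
    CliffordAlgebra.contractLeft (Q := (0 : QuadraticForm ℝ (E n))) α
      (a : ExteriorAlgebra ℝ (E n)) = 0 := by
  obtain ⟨e, -, he⟩ := contractLeft_mem_mspan a α
  suffices e = 0 by rw [he, this, map_zero]
  -- Contractions anticommute, so `β e = -α f`, where `f` represents `a ⌞ β` and lies in `mspan a ≤
  -- V`, on which `α` vanishes.
  refine (Module.forall_dual_apply_eq_zero_iff ℝ e).1 fun β => ?_
  obtain ⟨f, hf, hf'⟩ := contractLeft_mem_mspan a β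
  have h := CliffordAlgebra.contractLeft_comm (Q := (0 : QuadraticForm ℝ (E n)))
    (a : ExteriorAlgebra ℝ (E n)) (d := β) (d' := α)
  have h1 := CliffordAlgebra.contractLeft_ι (Q := (0 : QuadraticForm ℝ (E n))) β e
  have h2 := CliffordAlgebra.contractLeft_ι (Q := (0 : QuadraticForm ℝ (E n))) α f
  rw [he, hf'] at h
  erw [h1, h2] at h
  rw [hα f (ha hf), map_zero, neg_zero] at h
  exact (ExteriorAlgebra.algebraMap_eq_zero_iff _ _).1 h

/-- Euler's identity for `2`-vectors. -/
theorem sum_ι_mul_contractLeft {ι : Type*} [Fintype ι] (b : Module.Basis ι ℝ (E n))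
    (a : MultiVec n 2) :
    ∑ i, ExteriorAlgebra.ι ℝ (b i) *
        CliffordAlgebra.contractLeft (Q := (0 : QuadraticForm ℝ (E n))) (b.coord i)
          (a : ExteriorAlgebra ℝ (E n)) =
      (2 : ℝ) • (a : ExteriorAlgebra ℝ (E n)) := by
  have hb : a ∈ Submodule.span ℝ (range (exteriorPower.ιMulti ℝ 2 (M := E n))) := by
    rw [exteriorPower.ιMulti_span]; trivial
  induction hb using Submodule.span_induction with
  | mem x hx =>
    obtain ⟨y, rfl⟩ := hx
    have h : ∀ x : E n, ∑ i, b.coord i x • ExteriorAlgebra.ι ℝ (b i) = ExteriorAlgebra.ι ℝ x := by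
      intro x
      conv_rhs => rw [← b.sum_repr x, map_sum]
      simp
    have hs := ExteriorAlgebra.ι_add_mul_swap (R := ℝ) (y 1) (y 0)
    calc _ = ∑ i, ((b.coord i (y 0) • ExteriorAlgebra.ι ℝ (b i)) * ExteriorAlgebra.ι ℝ (y 1) -
            (b.coord i (y 1) • ExteriorAlgebra.ι ℝ (b i)) * ExteriorAlgebra.ι ℝ (y 0)) := by
          refine Finset.sum_congr rfl fun i _ => ?_
          rw [exteriorPower.ιMulti_apply_coe, contractLeft_ιMulti]
          simp [Fin.sum_univ_two, ExteriorAlgebra.ιMulti_succ_apply, Fin.removeNth,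
            sub_eq_add_neg, Matrix.vecTail, mul_add]
      _ = ExteriorAlgebra.ι ℝ (y 0) * ExteriorAlgebra.ι ℝ (y 1) -
            ExteriorAlgebra.ι ℝ (y 1) * ExteriorAlgebra.ι ℝ (y 0) := by
          rw [Finset.sum_sub_distrib, ← Finset.sum_mul, ← Finset.sum_mul, h, h]
      _ = _ := by
          rw [eq_neg_of_add_eq_zero_left hs, two_smul, sub_neg_eq_add]
          simp [ExteriorAlgebra.ιMulti_succ_apply, Matrix.vecTail]
  | zero => simp
  | add x y _ _ hx hy => simp [mul_add, Finset.sum_add_distrib, hx, hy]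
  | smul c x _ hx => simp [← Finset.smul_sum, hx, smul_comm c]

end Algebra

/-! ### Continuous versions of the algebraic operations -/

section Continuity

variable {n : ℕ}

/-- Left multiplication of a `k`-vector by a vector, as a bilinear map. -/
def vecMulₗ (n k : ℕ) : E n →ₗ[ℝ] MultiVec n k →ₗ[ℝ] MultiVec n (k + 1) :=
  LinearMap.mk₂ ℝ
    (fun x a => ⟨ExteriorAlgebra.ι ℝ x * (a : ExteriorAlgebra ℝ (E n)), by
      rw [ExteriorAlgebra.exteriorPower, pow_succ']
      exact Submodule.mul_mem_mul ⟨x, rfl⟩ a.2⟩)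
    (fun a a' b => Subtype.ext (by simp [add_mul])) (fun c a b => Subtype.ext (by simp))
    (fun a b b' => Subtype.ext (by simp [mul_add])) (fun c a b => Subtype.ext (by simp))

theorem ιMulti_succ_eq_vecMulₗ {k : ℕ} (a : Fin (k + 1) → E n) :
    exteriorPower.ιMulti ℝ (k + 1) a =
      vecMulₗ n k (a 0) (exteriorPower.ιMulti ℝ k (Matrix.vecTail a)) :=
  Subtype.ext (ExteriorAlgebra.ιMulti_succ_apply (R := ℝ) a)

theorem continuous_ιMulti (n k : ℕ) :
    Continuous (fun a : Fin k → E n => (exteriorPower.ιMulti ℝ k a : MultiVec n k)) := by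
  induction k with
  | zero => exact continuous_of_const fun a b => by rw [Subsingleton.elim a b]
  | succ k ih =>
    simp_rw [ιMulti_succ_eq_vecMulₗ]
    have h : Continuous fun a : Fin (k + 1) → E n => Matrix.vecTail a :=
      continuous_pi fun i => continuous_apply i.succ
    exact (((vecMulₗ n k).toContinuousBilinearMap.continuous.comp
      (continuous_apply 0)).clm_apply (ih.comp h))

/-- The universal alternating map into `Λ_k(ℝⁿ)`, as a continuous alternating map. -/
def ιMultiCLM (n k : ℕ) : E n [⋀^Fin k]→L[ℝ] MultiVec n k :=
  { exteriorPower.ιMulti ℝ k with cont := continuous_ιMulti n k }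

@[simp]
theorem ιMultiCLM_apply {k : ℕ} (a : Fin k → E n) :
    ιMultiCLM n k a = exteriorPower.ιMulti ℝ k a := rfl

/-- The wedge product as a continuous bilinear map. -/
def wedgeL (n k l : ℕ) : MultiVec n k →L[ℝ] MultiVec n l →L[ℝ] MultiVec n (k + l) :=
  (wedgeₗ n k l).toContinuousBilinearMap

@[simp]
theorem wedgeL_apply {k l : ℕ} (a : MultiVec n k) (b : MultiVec n l) :
    wedgeL n k l a b = wedge a b := rfl

/-- The interior product with a fixed covector as a continuous linear map. -/
def interiorProdL {k : ℕ} (α : Module.Dual ℝ (E n)) : MultiVec n (k + 1) →L[ℝ] MultiVec n k :=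
  (interiorProdₗ n k α).toContinuousLinearMap

@[simp]
theorem interiorProdL_apply {k : ℕ} (a : MultiVec n (k + 1)) (α : Module.Dual ℝ (E n)) :
    interiorProdL α a = interiorProd a α := rfl

theorem pairing_ιMulti {k : ℕ} (a : Fin k → E n) (α : Covec n k) :
    pairing (exteriorPower.ιMulti ℝ k a) α = α a :=
  exteriorPower.alternatingMapLinearEquiv_apply_ιMulti _ _

theorem stdBasis_apply {k : ℕ} (s : Set.powersetCard (Fin n) k) :
    stdBasis n k s = exteriorPower.ιMulti ℝ k fun i =>
      (EuclideanSpace.basisFun (Fin n) ℝ).toBasis (Set.powersetCard.ofFinEmbEquiv.symm s i) := by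
  rw [stdBasis, exteriorPower.coe_basis]
  rfl

/-- The duality pairing as a continuous bilinear map. -/
def pairingL (n k : ℕ) : MultiVec n k →L[ℝ] Covec n k →L[ℝ] ℝ :=
  LinearMap.toContinuousLinearMap ((stdBasis n k).constr ℝ fun s =>
    ContinuousAlternatingMap.apply ℝ (E n) ℝ fun i =>
      (EuclideanSpace.basisFun (Fin n) ℝ).toBasis (Set.powersetCard.ofFinEmbEquiv.symm s i))

theorem pairingL_apply {k : ℕ} (a : MultiVec n k) (α : Covec n k) :
    pairingL n k a α = pairing a α := by
  have h : (ContinuousLinearMap.apply ℝ ℝ α).toLinearMap ∘ₗ (pairingL n k).toLinearMap =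
      exteriorPower.alternatingMapLinearEquiv α.toAlternatingMap := by
    refine (stdBasis n k).ext fun s => ?_
    refine Eq.trans ?_ (pairing_ιMulti _ _).symm |>.trans
      (congrArg (fun a => pairing a α) (stdBasis_apply s).symm)
    simp [pairingL]
  exact LinearMap.congr_fun h a

/-- The covector `a ↦ ⟨a ∧ b, ℓ⟩`. -/
def wedgeCovec {k l : ℕ} (ℓ : MultiVec n (k + l) →L[ℝ] ℝ) : MultiVec n l →L[ℝ] Covec n k :=
  LinearMap.toContinuousLinearMap
    { toFun := fun b =>
        (ℓ.comp ((wedgeL n k l).flip b)).compContinuousAlternatingMap (ιMultiCLM n k)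
      map_add' := fun b c => by ext; simp
      map_smul' := fun t b => by ext; simp }

/-- Both sides are linear in `a`, so simple `a` suffice. This makes `wedgeCovec` the device that
converts a pairing with a form into a scalar component of a wedge product. -/
theorem pairing_wedgeCovec {k l : ℕ} (ℓ : MultiVec n (k + l) →L[ℝ] ℝ) (a : MultiVec n k)
    (b : MultiVec n l) : pairing a (wedgeCovec ℓ b) = ℓ (wedge a b) := by
  have h : exteriorPower.alternatingMapLinearEquiv (wedgeCovec ℓ b).toAlternatingMap =
      (ℓ.comp ((wedgeL n k l).flip b)).toLinearMap := by
    refine exteriorPower.linearMap_ext (AlternatingMap.ext fun a => ?_)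
    exact pairing_ιMulti a (wedgeCovec ℓ b)
  exact LinearMap.congr_fun h a

/-- The pairing of a simple vector with an antisymmetrised covector-valued linear map, in terms
of interior products with the coordinate covectors. -/
theorem pairing_alternatizeUncurryFin {k : ℕ} (a : Fin (k + 1) → E n)
    (L : E n →L[ℝ] Covec n k) :
    pairing (exteriorPower.ιMulti ℝ (k + 1) a)
        (ContinuousAlternatingMap.alternatizeUncurryFin L) =
      ∑ j : Fin n, pairing (interiorProd (exteriorPower.ιMulti ℝ (k + 1) a)
        (EuclideanSpace.proj j : E n →L[ℝ] ℝ).toLinearMap)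
        (L (EuclideanSpace.single j 1)) := by
  have h1 : ∀ α : Module.Dual ℝ (E n), interiorProd (exteriorPower.ιMulti ℝ (k + 1) a) α =
      ∑ i : Fin (k + 1), ((-1 : ℝ) ^ (i : ℕ) * α (a i)) •
        exteriorPower.ιMulti ℝ k (i.removeNth a) := fun α => Subtype.ext <| by
    rw [coe_interiorProd, exteriorPower.ιMulti_apply_coe, contractLeft_ιMulti]
    simp
  have h2 : ∀ x : E n, L x = ∑ j : Fin n, x j • L (EuclideanSpace.single j 1) := by
    intro x
    conv_lhs => rw [← (EuclideanSpace.basisFun (Fin n) ℝ).sum_repr x]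
    simp
  rw [pairing_ιMulti, ContinuousAlternatingMap.alternatizeUncurryFin_apply]
  simp_rw [h1, ← pairingL_apply, map_sum, _root_.sum_apply, map_smul,
    _root_.smul_apply, pairingL_apply, pairing_ιMulti]
  -- Both sides are now sums over the omitted slot `i`; expanding `L (a i)` in coordinates `j`
  -- matches them term by term.
  rw [Finset.sum_comm]
  refine Finset.sum_congr rfl fun i _ => ?_
  rw [h2, ContinuousAlternatingMap.sum_apply, Finset.smul_sum]
  refine Finset.sum_congr rfl fun j _ => ?_
  simp [mul_assoc]

end Continuity

/-! ### Fields tangent to a distribution -/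

section Tangent

variable {n m : ℕ} {Ω : Opens (E n)} {u : Fin (m + 1) → E n → E n} {V : Ω → Submodule ℝ (E n)}
  {w : E n → MultiVec n 2}

theorem differentiableAt_simpleField {x : E n} (hu : ∀ i, DifferentiableAt ℝ (u i) x) :
    DifferentiableAt ℝ (simpleField u) x :=
  ((ιMultiCLM n (m + 1)).differentiable _).comp x (differentiableAt_pi.2 hu)

/-- A contraction of `w x` is a vector of `V x`, hence a linear combination of the factors of the
simple field. -/
theorem wedge_simpleField_interiorProd_eq_zero (huV : Spans u V) (hwV : IsTangentField w V)
    (x : Ω) (α : Module.Dual ℝ (E n)) :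
    wedge (simpleField u x) (interiorProd (w x) α) = 0 := by
  obtain ⟨e, he, h⟩ := contractLeft_mem_mspan (w x) α
  refine Subtype.ext ?_
  rw [coe_wedge, coe_interiorProd, h]
  exact ιMulti_mul_ι_eq_zero _ ((huV x).le (hwV x he))

/-- The first derivatives of a `2`-vectorfield tangent to the span of `u₁, …, u_k` are annihilated
by `u₁ ∧ ⋯ ∧ u_k`. -/
theorem wedge_simpleField_fderiv_eq_zero (hu : ∀ i, ContDiffOn ℝ 1 (u i) Ω) (huV : Spans u V)
    (hw : ContDiffOn ℝ 1 w Ω) (hwV : IsTangentField w V) (x : Ω) (e : E n) :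
    wedge (simpleField u x) (fderiv ℝ w x e) = 0 := by
  have hΩ : (Ω : Set (E n)) ∈ nhds (x : E n) := Ω.isOpen.mem_nhds x.2
  have hvd : DifferentiableAt ℝ (simpleField u) x := differentiableAt_simpleField fun i =>
    ((hu i).contDiffAt hΩ).differentiableAt one_ne_zero
  have hwd : DifferentiableAt ℝ w x := (hw.contDiffAt hΩ).differentiableAt one_ne_zero
  set D := fderiv ℝ w x e
  -- With `α` held constant, `v ∧ (w ⌞ α)` vanishes throughout `Ω`, so its derivative does too. The
  -- term in which `v` is differentiated carries `w(x) ⌞ α`, which is zero because `α` vanishes on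
  -- `V x`; this is needed only at the point `x`.
  have key : ∀ α : Module.Dual ℝ (E n), (∀ y ∈ V x, α y = 0) →
      wedge (simpleField u x) (interiorProd D α) = 0 := by
    intro α hα
    have h1 := (wedgeL n (m + 1) 1).hasFDerivAt_of_bilinear hvd.hasFDerivAt
      ((interiorProdL α).hasFDerivAt.comp (x : E n) hwd.hasFDerivAt)
    have h2 : HasFDerivAt (fun y => wedgeL n (m + 1) 1 (simpleField u y)
        ((interiorProdL α ∘ w) y)) (0 : E n →L[ℝ] MultiVec n (m + 1 + 1)) x := by
      refine (hasFDerivAt_const (0 : MultiVec n (m + 1 + 1)) (x : E n)).congr_of_eventuallyEq ?_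
      filter_upwards [hΩ] with y hy
      exact wedge_simpleField_interiorProd_eq_zero huV hwV ⟨y, hy⟩ α
    have h3 := congrArg (fun L => L e) (h1.unique h2)
    have h4 : interiorProd (w x) α = 0 :=
      Subtype.ext (contractLeft_eq_zero_of_mspan_le (hwV x) α hα)
    simpa [h4, ContinuousLinearMap.precompR, ContinuousLinearMap.precompL, ← wedgeL_apply]
      using h3
  -- In a basis adapted to `V x ⊕ W`, Euler's identity writes `2D` as the sum of `bᵢ ∧ (D ⌞ bᵢ*)`.
  -- If `bᵢ` lies in `V x`, it is killed by `v`; otherwise `bᵢ*` vanishes on `V x` and `key` kills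
  -- the other factor.
  obtain ⟨W, hW⟩ := (V x).exists_isCompl
  let b := ((Module.finBasis ℝ (V x)).prod (Module.finBasis ℝ W)).map
    (Submodule.prodEquivOfIsCompl _ _ hW)
  suffices h : (2 : ℝ) • (simpleField u x : ExteriorAlgebra ℝ (E n)) * D = 0 by
    refine Subtype.ext ?_
    rw [smul_mul_assoc] at h
    exact (smul_eq_zero.1 h).resolve_left two_ne_zero
  rw [smul_mul_assoc, ← mul_smul_comm, ← sum_ι_mul_contractLeft b, Finset.mul_sum]
  refine Finset.sum_eq_zero fun i _ => ?_
  rcases i with i | i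
  · have hb : b (Sum.inl i) ∈ V x := by simp [b]
    rw [← mul_assoc]
    have := ιMulti_mul_ι_eq_zero (fun i => u i x) ((huV x).le hb)
    exact (congrArg (· * _) this).trans (zero_mul _)
  · have hc : ∀ y ∈ V x, b.coord (Sum.inr i) y = 0 := by
      intro y hy
      have : (Submodule.prodEquivOfIsCompl _ _ hW).symm y = ((⟨y, hy⟩ : V x), (0 : W)) := by
        rw [LinearEquiv.symm_apply_eq]; simp
      simp [b, this]
    have h1 := congrArg Subtype.val (key _ hc)
    rw [coe_wedge, coe_interiorProd] at h1
    -- The contraction of `D` is a vector, so it can be swapped past `bᵢ` to stand next to `v`.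
    obtain ⟨f, -, hf⟩ := contractLeft_mem_mspan D (b.coord (Sum.inr i))
    have hcomm : ∀ (k : ℕ) (a : Fin k → E n) (y z : E n),
        ExteriorAlgebra.ιMulti ℝ k a * (ExteriorAlgebra.ι ℝ y * ExteriorAlgebra.ι ℝ z) =
        -(ExteriorAlgebra.ιMulti ℝ k a * ExteriorAlgebra.ι ℝ z * ExteriorAlgebra.ι ℝ y) := by
      intro k a y z
      rw [eq_neg_of_add_eq_zero_left (ExteriorAlgebra.ι_add_mul_swap (R := ℝ) y z), mul_neg,
        mul_assoc]
    rw [hf] at h1 ⊢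
    refine (hcomm _ _ _ _).trans ?_
    erw [h1]
    simp

/-- For a `2`-vectorfield tangent to `V`, the contraction of the simple field against the gradient
of the field is `v ∧ div w`, up to sign. -/
theorem sum_wedge_interiorProd_fderiv (hu : ∀ i, ContDiffOn ℝ 1 (u i) Ω) (huV : Spans u V)
    (hw : ContDiffOn ℝ 1 w Ω) (hwV : IsTangentField w V) (x : Ω) :
    ∑ j : Fin n, wedge (interiorProd (simpleField u x)
        (EuclideanSpace.proj j : E n →L[ℝ] ℝ).toLinearMap)
        (fderiv ℝ w x (EuclideanSpace.single j 1)) =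
      (-1 : ℝ) ^ m • wedge (k := m + 1) (l := 1) (simpleField u x) (divergence w x) := by
  have h : wedge (k := m + 1) (l := 1) (simpleField u x) (divergence w x) =
      ∑ j : Fin n, wedge (simpleField u x) (interiorProd
        (fderiv ℝ w x (EuclideanSpace.single j 1))
        (EuclideanSpace.proj j : E n →L[ℝ] ℝ).toLinearMap) :=
    map_sum (wedgeₗ n (m + 1) 1 (simpleField u x)) _ _
  rw [h, Finset.smul_sum]
  refine Finset.sum_congr rfl fun j _ => Subtype.ext ?_
  have h1 := coe_wedge_interiorProd (fun i => u i x) (fderiv ℝ w x (EuclideanSpace.single j 1))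
    (EuclideanSpace.proj j : E n →L[ℝ] ℝ).toLinearMap
  have h2 := congrArg Subtype.val
    (wedge_simpleField_fderiv_eq_zero hu huV hw hwV x (EuclideanSpace.single j 1))
  -- The Leibniz rule now reads `0 = A + (-1)^(m+1) B`, whence the sign `(-1)^m`.
  erw [h2, map_zero] at h1
  refine (eq_neg_of_add_eq_zero_left h1.symm).trans ?_
  rw [pow_succ, mul_neg_one, neg_smul, neg_neg]
  rfl

end Tangent

/-! ### Smoothing of compactly supported `C¹` functions -/

section Smoothing

variable {n : ℕ} {Ω : Opens (E n)} {G : Type*} [NormedAddCommGroup G] [NormedSpace ℝ G]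

/-- The kernel is a probability density, so averaging does not increase the sup bound; this is
`dist_convolution_le` with comparison value `z₀ = 0`. -/
theorem norm_normed_convolution_le [CompleteSpace G] (φ : ContDiffBump (0 : E n)) {g : E n → G}
    (hg : Continuous g) {C : ℝ} (hC : ∀ x, ‖g x‖ ≤ C) (x : E n) :
    ‖convolution (φ.normed volume) g (ContinuousLinearMap.lsmul ℝ ℝ) volume x‖ ≤ C := by
  have h := dist_convolution_le (μ := (volume : Measure (E n))) (f := φ.normed volume) (g := g)
    (x₀ := x) (R := φ.rOut) (ε := C) (z₀ := 0) ((norm_nonneg _).trans (hC 0))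
    φ.support_normed_eq.subset φ.nonneg_normed φ.integral_normed hg.aestronglyMeasurable
    (fun y _ => by simpa using hC y)
  simpa using h

/-- The derivative is put on `g` rather than on the bump, so that derivatives of mollifications are
mollifications of a continuous function. -/
theorem fderiv_normed_convolution (φ : ContDiffBump (0 : E n)) {g : E n → G}
    (hg : ContDiff ℝ 1 g) (hcg : HasCompactSupport g) (x : E n) :
    fderiv ℝ (convolution (φ.normed volume) g (ContinuousLinearMap.lsmul ℝ ℝ) volume) x =
      convolution (φ.normed volume) (fderiv ℝ g) (ContinuousLinearMap.lsmul ℝ ℝ) volume x := by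
  have hφ : LocallyIntegrable (φ.normed volume) (volume : Measure (E n)) :=
    φ.continuous_normed.locallyIntegrable
  rw [(hcg.hasFDerivAt_convolution_right (ContinuousLinearMap.lsmul ℝ ℝ) hφ hg x).fderiv]
  rfl

/-- A `C¹` function with compact support in `Ω` is the limit of test functions, pointwise together
with the first derivatives, and boundedly. -/
theorem exists_testFunction_tendsto [CompleteSpace G] {η : E n → G} (hη : ContDiff ℝ 1 η)
    (hc : HasCompactSupport η) (hs : tsupport η ⊆ Ω) :
    ∃ (ω : ℕ → 𝓓(Ω, G)) (C : ℝ), (∀ i x, ‖ω i x‖ ≤ C) ∧ (∀ i x, ‖fderiv ℝ (ω i) x‖ ≤ C) ∧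
      (∀ x, Filter.Tendsto (fun i => ω i x) Filter.atTop (nhds (η x))) ∧
      ∀ x, Filter.Tendsto (fun i => fderiv ℝ (ω i) x) Filter.atTop (nhds (fderiv ℝ η x)) := by
  obtain ⟨δ, hδ, hδΩ⟩ := hc.isCompact.exists_cthickening_subset_open Ω.isOpen hs
  -- Outer radii at most `δ` keep the mollified supports in the closed `δ`-thickening, which lies in
  -- `Ω`; the inner radius is half the outer one.
  let φ : ℕ → ContDiffBump (0 : E n) := fun i =>
    { rIn := δ / (2 * (i + 1)), rOut := δ / (i + 1), rIn_pos := by positivity,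
      rIn_lt_rOut := by
        apply div_lt_div_of_pos_left hδ (by positivity)
        have : (0 : ℝ) < i + 1 := by positivity
        linarith }
  have hφ : Filter.Tendsto (fun i => (φ i).rOut) Filter.atTop (nhds 0) :=
    tendsto_const_nhds.div_atTop
      (Filter.tendsto_atTop_add_const_right _ _ tendsto_natCast_atTop_atTop)
  have hle : ∀ i, (φ i).rOut ≤ δ := fun i =>
    div_le_self hδ.le (by linarith [(Nat.cast_nonneg i : (0 : ℝ) ≤ i)])
  have hη' : Continuous (fderiv ℝ η) := hη.continuous_fderiv one_ne_zero
  obtain ⟨C₁, hC₁⟩ := hη.continuous.bounded_above_of_compact_support hc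
  obtain ⟨C₂, hC₂⟩ := hη'.bounded_above_of_compact_support (hc.fderiv ℝ)
  let f : ℕ → E n → G := fun i =>
    convolution ((φ i).normed volume) η (ContinuousLinearMap.lsmul ℝ ℝ) volume
  let ω : ℕ → 𝓓(Ω, G) := fun i =>
    { toFun := f i
      contDiff' := (φ i).hasCompactSupport_normed.contDiff_convolution_left
        (ContinuousLinearMap.lsmul ℝ ℝ) (φ i).contDiff_normed hη.continuous.locallyIntegrable
      hasCompactSupport' := (φ i).hasCompactSupport_normed.convolution
        (ContinuousLinearMap.lsmul ℝ ℝ) hc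
      tsupport_subset' := by
        refine (closure_minimal ?_ Metric.isClosed_cthickening).trans hδΩ
        refine (support_convolution_subset _).trans ?_
        rintro _ ⟨y, hy, z, hz, rfl⟩
        rw [(φ i).support_normed_eq, mem_ball_zero_iff] at hy
        refine Metric.mem_cthickening_of_dist_le _ z _ _ (subset_tsupport _ hz) ?_
        simpa [dist_eq_norm] using hy.le.trans (hle i) }
  have hf' : ∀ i x, fderiv ℝ (ω i) x =
      convolution ((φ i).normed volume) (fderiv ℝ η) (ContinuousLinearMap.lsmul ℝ ℝ) volume x :=
    fun i x => fderiv_normed_convolution (φ i) hη hc x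
  refine ⟨ω, max C₁ C₂, fun i x => ?_, fun i x => ?_, fun x => ?_, fun x => ?_⟩
  · exact (norm_normed_convolution_le (φ i) hη.continuous hC₁ x).trans (le_max_left _ _)
  · rw [hf']
    exact (norm_normed_convolution_le (φ i) hη' hC₂ x).trans (le_max_right _ _)
  · exact ContDiffBump.convolution_tendsto_right_of_continuous hφ hη.continuous x
  · simp_rw [hf']
    exact ContDiffBump.convolution_tendsto_right_of_continuous hφ hη' x

end Smoothing

/-! ### The boundary identity for `C¹` forms -/

section Boundary

variable {n k : ℕ} {Ω : Opens (E n)}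

theorem exists_norm_bilinear_le {F₁ F₂ F₃ : Type*} [NormedAddCommGroup F₁] [NormedSpace ℝ F₁]
    [NormedAddCommGroup F₂] [NormedSpace ℝ F₂] [NormedAddCommGroup F₃] [NormedSpace ℝ F₃]
    (B : F₁ →L[ℝ] F₂ →L[ℝ] F₃) :
    ∃ C : ℝ, 0 ≤ C ∧ ∀ x y, ‖B x y‖ ≤ C * ‖x‖ * ‖y‖ :=
  ⟨‖B‖, B.opNorm_nonneg, B.le_opNorm₂⟩

theorem exists_norm_pairing_le (n k : ℕ) :
    ∃ C : ℝ, 0 ≤ C ∧ ∀ (a : MultiVec n k) (α : Covec n k), ‖pairing a α‖ ≤ C * ‖a‖ * ‖α‖ := by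
  simp_rw [← pairingL_apply]
  exact exists_norm_bilinear_le (pairingL n k)

/-- Dominated convergence: since `τ` is integrable, bounded pointwise convergence of the forms
suffices. -/
theorem tendsto_integral_pairing {μ : Measure Ω} {τ : Ω → MultiVec n k} (hτ : Integrable τ μ)
    {f : ℕ → E n → Covec n k} {g : E n → Covec n k} (hf : ∀ i, Continuous (f i)) {C : ℝ}
    (hC : ∀ i x, ‖f i x‖ ≤ C) (h : ∀ x, Filter.Tendsto (fun i => f i x) Filter.atTop (nhds (g x))) :
    Filter.Tendsto (fun i => ∫ x : Ω, pairing (τ x) (f i x) ∂μ) Filter.atTop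
      (nhds (∫ x : Ω, pairing (τ x) (g x) ∂μ)) := by
  obtain ⟨M, hM, hle⟩ := exists_norm_pairing_le n k
  simp_rw [← pairingL_apply] at hle ⊢
  refine tendsto_integral_of_dominated_convergence (fun x => M * ‖τ x‖ * C)
    (fun i => ?_) ((hτ.norm.const_mul _).mul_const _) (fun i => ?_) ?_
  · exact (pairingL n k).aestronglyMeasurable_comp₂ hτ.aestronglyMeasurable
      ((hf i).comp continuous_subtype_val).aestronglyMeasurable
  · exact Filter.Eventually.of_forall fun x => (hle _ _).trans
      (mul_le_mul_of_nonneg_left (hC i x) (by positivity))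
  · exact Filter.Eventually.of_forall fun x =>
      ((pairingL n k (τ x)).continuous.tendsto _).comp (h x)

/-- The identity `⟨∂T, η⟩ = ⟨T, dη⟩` extends to compactly supported forms of class `C¹`. -/
theorem integral_pairing_boundary {T : Current Ω (k + 1)} {τ : Ω → MultiVec n (k + 1)}
    {μ : SignedRadon Ω} (hμ : IsRepresentedSigned T τ μ) {τ' : Ω → MultiVec n k}
    {μ' : Measure Ω} (hμ' : IsRepresented (boundary T) τ' μ') {η : E n → Covec n k}
    (hη : ContDiff ℝ 1 η) (hc : HasCompactSupport η) (hs : tsupport η ⊆ Ω) :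
    ∫ x : Ω, pairing (τ' x) (η x) ∂μ' =
      μ.setIntegral univ fun x : Ω => pairing (τ x) (extDeriv η x) := by
  obtain ⟨ω, C, h1, h2, h3, h4⟩ := exists_testFunction_tendsto hη hc hs
  let A := ContinuousAlternatingMap.alternatizeUncurryFinCLM ℝ (E n) ℝ (n := k)
  have hlim : ∀ ν : Measure Ω, Integrable τ ν → Filter.Tendsto
      (fun i => ∫ x : Ω, pairing (τ x) (extDerivTest Ω k (ω i) x) ∂ν) Filter.atTop
      (nhds (∫ x : Ω, pairing (τ x) (extDeriv η x) ∂ν)) := by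
    intro ν hν
    -- The factor `k + 1` bounds the norm of the alternating sum over the `k + 1` slots.
    refine tendsto_integral_pairing (f := fun i x => extDerivTest Ω k (ω i) x) hν
      (fun i => (extDerivTest Ω k (ω i)).continuous) (C := (k + 1) * C) (fun i x => ?_) fun x => ?_
    · simp only [extDerivTest_apply]
      exact (ContinuousAlternatingMap.norm_alternatizeUncurryFin_le _).trans
        (mul_le_mul_of_nonneg_left (h2 i x) (by positivity))
    · simp only [extDerivTest_apply]
      exact (A.continuous.tendsto _).comp (h4 x)
  have hint := integrable_add_measure.1 hμ.1
  have hl := tendsto_integral_pairing (f := fun i x => ω i x) hμ'.2.1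
    (fun i => (ω i).continuous) h1 h3
  refine tendsto_nhds_unique hl (Filter.Tendsto.congr (fun i => ?_)
    (f₁ := fun i => μ.setIntegral univ fun x : Ω => pairing (τ x) (extDerivTest Ω k (ω i) x)) ?_)
  · rw [← hμ.2.2 (extDerivTest Ω k (ω i)), ← hμ'.2.2.2 (ω i)]
    rfl
  · simp only [SignedRadon.setIntegral, Measure.restrict_univ]
    exact (hlim _ hint.1).sub (hlim _ hint.2)

end Boundary

/-! ### Localisation -/

section Localisation

variable {n : ℕ} {Ω : Opens (E n)} {F : Type*} [NormedAddCommGroup F] [NormedSpace ℝ F]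

theorem hasCompactSupport_comp_subtype_val {G : Type*} [Zero G] {φ : E n → G}
    (hc : HasCompactSupport φ) (hs : tsupport φ ⊆ Ω) :
    HasCompactSupport fun x : Ω => φ x := by
  refine HasCompactSupport.intro (K := (Subtype.val : Ω → E n) ⁻¹' tsupport φ) ?_ ?_
  · exact Topology.IsInducing.subtypeVal.isCompact_preimage' hc.isCompact (by simpa using hs)
  · intro x hx
    exact image_eq_zero_of_notMem_tsupport hx

instance instLocallyCompactSpaceOpens (Ω : Opens (E n)) : LocallyCompactSpace Ω :=
  Ω.isOpen.locallyCompactSpace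

/-- A locally integrable density multiplied by a Radon–Nikodym derivative. -/
theorem locallyIntegrable_rnDeriv_smul {μ ν : Measure Ω} [SigmaFinite μ] [SigmaFinite ν]
    (hμν : μ ≪ ν) {f : Ω → F} (hf : LocallyIntegrable f μ) :
    LocallyIntegrable (fun x => (μ.rnDeriv ν x).toReal • f x) ν := by
  rw [locallyIntegrable_iff] at hf ⊢
  intro K hK
  have h := (integrable_rnDeriv_smul_iff hμν).2
    ((integrable_indicator_iff hK.measurableSet).2 (hf _ hK))
  rw [← integrable_indicator_iff hK.measurableSet]
  convert! h using 1
  funext x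
  by_cases hx : x ∈ K <;> simp [hx]

theorem setIntegral_rnDeriv_smul_eq {μ ν : Measure Ω} [SigmaFinite μ] [SigmaFinite ν]
    (hμν : μ ≪ ν) (f : Ω → F) {B : Set Ω} (hB : MeasurableSet B) :
    ∫ x in B, (μ.rnDeriv ν x).toReal • f x ∂ν = ∫ x in B, f x ∂μ := by
  rw [← integral_indicator hB, ← integral_indicator hB, ← integral_rnDeriv_smul hμν]
  congr 1
  funext x
  by_cases hx : x ∈ B <;> simp [hx]

/-- Pushing `ν` forward to `ℝⁿ` and extending `h` by zero reduces this to the fundamental lemma of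
the calculus of variations on an open set. -/
theorem ae_eq_zero_of_integral_testFunction_smul [CompleteSpace F] {ν : Measure Ω} {h : Ω → F}
    (hh : LocallyIntegrable h ν)
    (H : ∀ φ : E n → ℝ, ContDiff ℝ ((⊤ : ℕ∞) : WithTop ℕ∞) φ → HasCompactSupport φ →
      tsupport φ ⊆ Ω → ∫ x : Ω, φ x • h x ∂ν = 0) :
    ∀ᵐ x ∂ν, h x = 0 := by
  have he : MeasurableEmbedding (Subtype.val : Ω → E n) :=
    MeasurableEmbedding.subtype_coe Ω.isOpen.measurableSet
  let h' : E n → F := Function.extend Subtype.val h 0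
  have hh' : ∀ x : Ω, h' x = h x := fun x => Subtype.val_injective.extend_apply h 0 x
  have key : ∀ᵐ x ∂(ν.map Subtype.val), x ∈ (Ω : Set (E n)) → h' x = 0 := by
    refine Ω.isOpen.ae_eq_zero_of_integral_contDiff_smul_eq_zero ?_ fun φ h1 h2 h3 => ?_
    · rw [locallyIntegrableOn_iff Ω.isOpen.isLocallyClosed]
      intro K hKΩ hK
      rw [he.integrableOn_map_iff]
      have : h' ∘ Subtype.val = h := funext hh'
      rw [this]
      exact (locallyIntegrable_iff.1 hh) _
        (Topology.IsInducing.subtypeVal.isCompact_preimage' hK (by simpa using hKΩ))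
    · rw [he.integral_map]
      simp_rw [hh']
      exact H φ h1 h2 h3
  rw [he.ae_map_iff] at key
  filter_upwards [key] with x hx
  rw [← hh' x]
  exact hx x.2

/-- Two vector-valued Radon measures on `Ω` that agree on test functions agree on the Borel subsets
of compact sets. -/
theorem setIntegral_eq_of_integral_testFunction_smul [CompleteSpace F] {μ' : Measure Ω}
    [IsLocallyFiniteMeasure μ'] (μ : SignedRadon Ω) {f g : Ω → F} (hf : LocallyIntegrable f μ')
    (hg : LocallyIntegrable g μ.variation)
    (H : ∀ φ : E n → ℝ, ContDiff ℝ ((⊤ : ℕ∞) : WithTop ℕ∞) φ → HasCompactSupport φ →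
      tsupport φ ⊆ Ω →
        ∫ x : Ω, φ x • f x ∂μ' = μ.setIntegral univ fun x : Ω => φ x • g x)
    {K : Set Ω} (hK : IsCompact K) {B : Set Ω} (hBK : B ⊆ K) (hB : MeasurableSet B) :
    ∫ x in B, f x ∂μ' = μ.setIntegral B g := by
  have := μ.locallyFinite_pos
  have := μ.locallyFinite_neg
  have hgp : LocallyIntegrable g μ.pos := hg.mono_measure (Measure.le_add_right le_rfl)
  have hgn : LocallyIntegrable g μ.neg := hg.mono_measure (Measure.le_add_left le_rfl)
  -- All three measures have densities with respect to `ν`, so the equality of signed vector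
  -- measures becomes the almost everywhere vanishing of one locally integrable function.
  let ν : Measure Ω := μ' + (μ.pos + μ.neg)
  have hac : μ' ≪ ν := Measure.absolutelyContinuous_of_le (Measure.le_add_right le_rfl)
  have hacp : μ.pos ≪ ν := Measure.absolutelyContinuous_of_le
    (Measure.le_add_left (Measure.le_add_right le_rfl))
  have hacn : μ.neg ≪ ν := Measure.absolutelyContinuous_of_le
    (Measure.le_add_left (Measure.le_add_left le_rfl))
  have l1 := locallyIntegrable_rnDeriv_smul hac hf
  have l2 := locallyIntegrable_rnDeriv_smul hacp hgp
  have l3 := locallyIntegrable_rnDeriv_smul hacn hgn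
  have hae := ae_eq_zero_of_integral_testFunction_smul (l1.sub (l2.sub l3)) fun φ h1 h2 h3 => by
    have hφ : Continuous fun x : Ω => φ x := h1.continuous.comp continuous_subtype_val
    have hφc := hasCompactSupport_comp_subtype_val h2 h3
    have hint := fun {h : Ω → F} (hh : LocallyIntegrable h ν) =>
      hh.integrable_smul_left_of_hasCompactSupport hφ hφc
    have e : ∀ (ρ : Measure Ω) [SigmaFinite ρ], ρ ≪ ν → ∀ h : Ω → F,
        ∫ x : Ω, φ x • (ρ.rnDeriv ν x).toReal • h x ∂ν = ∫ x : Ω, φ x • h x ∂ρ := by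
      intro ρ _ hρ h
      rw [← integral_rnDeriv_smul hρ]
      simp_rw [smul_comm (φ _)]
    have := H φ h1 h2 h3
    simp only [SignedRadon.setIntegral, Measure.restrict_univ] at this
    simp only [Pi.sub_apply, smul_sub]
    refine (integral_sub (hint l1) ((hint l2).sub (hint l3))).trans ?_
    simp only [Pi.sub_apply]
    rw [integral_sub (hint l2) (hint l3), e _ hac, e _ hacp, e _ hacn, this, sub_self]
  -- Compactness of `K` makes each term integrable on `B` separately, which allows the integral to
  -- be split.
  have hi := fun {h : Ω → F} (hh : LocallyIntegrable h ν) =>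
    ((locallyIntegrable_iff.1 hh) _ hK).mono_set hBK
  have hz : ∫ x in B, ((μ'.rnDeriv ν x).toReal • f x - ((μ.pos.rnDeriv ν x).toReal • g x -
      (μ.neg.rnDeriv ν x).toReal • g x)) ∂ν = 0 := by
    refine integral_eq_zero_of_ae (ae_restrict_of_ae ?_)
    filter_upwards [hae] with x hx using hx
  replace hz := (integral_sub (hi l1) ((hi l2).sub (hi l3))).symm.trans hz
  simp only [Pi.sub_apply] at hz
  rw [integral_sub (hi l2) (hi l3), setIntegral_rnDeriv_smul_eq hac _ hB, setIntegral_rnDeriv_smul_eq hacp _ hB,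
    setIntegral_rnDeriv_smul_eq hacn _ hB] at hz
  exact sub_eq_zero.1 hz

end Localisation

/-! ### The identity on test functions -/

section Main

variable {n m : ℕ} {Ω : Opens (E n)} {u : Fin (m + 1) → E n → E n} {V : Ω → Submodule ℝ (E n)}
  {w : E n → MultiVec n 2}

instance instCompleteSpaceMultiVec (n k : ℕ) : CompleteSpace (MultiVec n k) :=
  FiniteDimensional.complete ℝ _

theorem mspan_smul_le {k : ℕ} (c : ℝ) (a : MultiVec n k) : mspan (c • a) ≤ mspan a :=
  sInf_le_sInf fun W hW =>
    (LinearMap.range (exteriorPower.map k W.subtype)).smul_mem c hW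

theorem IsTangentField.smul (hwV : IsTangentField w V) (φ : E n → ℝ) :
    IsTangentField (fun y => φ y • w y) V :=
  fun x => (mspan_smul_le _ _).trans (hwV x)

/-- The field `f` is controlled only on `Ω`, but the product is locally zero off `tsupport φ`. This
supplies globally `C¹` forms for the mollification. -/
theorem contDiff_smul_of_tsupport_subset {G : Type*} [NormedAddCommGroup G] [NormedSpace ℝ G]
    {f : E n → G} (hf : ContDiffOn ℝ 1 f Ω) {φ : E n → ℝ} (hφ : ContDiff ℝ 1 φ)
    (hs : tsupport φ ⊆ Ω) : ContDiff ℝ 1 fun y => φ y • f y := by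
  rw [contDiff_iff_contDiffAt]
  intro x
  by_cases hx : x ∈ tsupport φ
  · exact hφ.contDiffAt.smul (hf.contDiffAt (Ω.isOpen.mem_nhds (hs hx)))
  · refine (contDiffAt_const (c := (0 : G))).congr_of_eventuallyEq ?_
    filter_upwards [(isClosed_tsupport φ).isOpen_compl.mem_nhds hx] with y hy
    rw [image_eq_zero_of_notMem_tsupport hy, zero_smul]

/-- The product rule adds only the contraction of `w` with `dφ`, which the simple field annihilates.
-/
theorem wedge_simpleField_divergence_smul (huV : Spans u V) (hw : ContDiffOn ℝ 1 w Ω)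
    (hwV : IsTangentField w V) {φ : E n → ℝ} (hφ : ContDiff ℝ 1 φ) (x : Ω) :
    wedge (k := m + 1) (l := 1) (simpleField u x) (divergence (fun y => φ y • w y) x) =
      φ x • wedge (k := m + 1) (l := 1) (simpleField u x) (divergence w x) := by
  have hwd : DifferentiableAt ℝ w x :=
    (hw.contDiffAt (Ω.isOpen.mem_nhds x.2)).differentiableAt one_ne_zero
  have hφd : DifferentiableAt ℝ φ x := hφ.contDiffAt.differentiableAt one_ne_zero
  have h1 : divergence (k := 1) (fun y => φ y • w y) x = φ x • divergence (k := 1) w x +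
      ∑ j : Fin n, fderiv ℝ φ x (EuclideanSpace.single j 1) •
        interiorProd (k := 1) (w x) (EuclideanSpace.proj j : E n →L[ℝ] ℝ).toLinearMap := by
    rw [divergence, divergence, Finset.smul_sum, ← Finset.sum_add_distrib]
    refine Finset.sum_congr rfl fun j _ => ?_
    have h := (hφd.hasFDerivAt.smul hwd.hasFDerivAt).fderiv
    have h' : fderiv ℝ (fun y => φ y • w y) x (EuclideanSpace.single j 1) =
        φ x • fderiv ℝ w x (EuclideanSpace.single j 1) +
          fderiv ℝ φ x (EuclideanSpace.single j 1) • w x := congrArg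
          (fun L : E n →L[ℝ] MultiVec n 2 => L (EuclideanSpace.single j 1)) h
    rw [h']
    simp only [← interiorProdₗ_apply, map_add, map_smul]
  rw [h1]
  simp only [← wedgeₗ_apply, map_add, map_smul, map_sum]
  simp only [wedgeₗ_apply, wedge_simpleField_interiorProd_eq_zero huV hwV, smul_zero,
    Finset.sum_const_zero, add_zero]

/-- The differential of the form `a ↦ ⟨a ∧ φw, ℓ⟩`, paired with `u₁ ∧ ⋯ ∧ u_k`. -/
theorem pairing_extDeriv_wedgeCovec (hu : ∀ i, ContDiffOn ℝ 1 (u i) Ω) (huV : Spans u V)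
    (hw : ContDiffOn ℝ 1 w Ω) (hwV : IsTangentField w V) (ℓ : MultiVec n (m + 2) →L[ℝ] ℝ)
    {φ : E n → ℝ} (hφ : ContDiff ℝ 1 φ) (hs : tsupport φ ⊆ Ω) (x : Ω) :
    pairing (simpleField u x) (extDeriv (fun y => wedgeCovec ℓ (φ y • w y)) x) =
      ℓ (φ x • (-1 : ℝ) ^ m • wedge (k := m + 1) (l := 1) (simpleField u x)
        (divergence w x)) := by
  have hc := contDiff_smul_of_tsupport_subset hw hφ hs
  have hd : fderiv ℝ (fun y => wedgeCovec ℓ (φ y • w y)) x =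
      (wedgeCovec ℓ).comp (fderiv ℝ (fun y => φ y • w y) x) :=
    ((wedgeCovec ℓ).hasFDerivAt.comp (x : E n)
      (hc.contDiffAt.differentiableAt one_ne_zero).hasFDerivAt).fderiv
  rw [extDeriv, hd]
  refine (pairing_alternatizeUncurryFin _ _).trans ?_
  simp only [ContinuousLinearMap.comp_apply, pairing_wedgeCovec]
  -- The divergence formula is applied to `φw`, itself tangent to `V`; the cutoff is pulled out of
  -- the divergence separately.
  rw [← map_sum, smul_comm, ← wedge_simpleField_divergence_smul huV hw hwV hφ x,
    ← sum_wedge_interiorProd_fderiv hu huV hc.contDiffOn (hwV.smul φ) x]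
  rfl

theorem locallyIntegrable_wedge {k l : ℕ} {ν : Measure Ω} {τ : Ω → MultiVec n k}
    (hτ : Integrable τ ν) {f : Ω → MultiVec n l} (hf : Continuous f) :
    LocallyIntegrable (fun x => wedge (τ x) (f x)) ν := by
  rw [locallyIntegrable_iff]
  intro K hK
  obtain ⟨M, hM⟩ := hK.exists_bound_of_continuousOn hf.continuousOn
  obtain ⟨C, hC, hle⟩ := exists_norm_bilinear_le (wedgeL n k l)
  refine Integrable.mono' ((hτ.norm.const_mul C).mul_const M).integrableOn ?_ ?_
  · exact (wedgeL n k l).aestronglyMeasurable_comp₂ hτ.aestronglyMeasurable.restrict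
      hf.aestronglyMeasurable
  · filter_upwards [ae_restrict_mem hK.measurableSet] with x hx
    exact (hle _ _).trans (mul_le_mul_of_nonneg_left (hM x hx) (by positivity))

theorem continuous_divergence {k : ℕ} {w : E n → MultiVec n (k + 1)}
    (hw : ContDiffOn ℝ 1 w Ω) : Continuous fun x : Ω => divergence w x := by
  have h : Continuous fun x : Ω => fderiv ℝ w x :=
    (hw.continuousOn_fderiv_of_isOpen Ω.isOpen le_rfl).comp_continuous continuous_subtype_val
      fun x => x.2
  exact continuous_finsetSum _ fun j _ => (interiorProdL _).continuous.comp
    (h.clm_apply continuous_const)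

/-- The boundary of `T = vμ` wedged with a tangent `2`-vectorfield, tested against a function. -/
theorem integral_smul_wedge_boundary (hu : ∀ i, ContDiffOn ℝ 1 (u i) Ω) (huV : Spans u V)
    {T : Current Ω (m + 1)} {μ : SignedRadon Ω}
    (hμ : IsRepresentedSigned T (fun x => simpleField u x) μ)
    {τ' : Ω → MultiVec n m} {μ' : Measure Ω} (hμ' : IsRepresented (boundary T) τ' μ')
    (hw : ContDiffOn ℝ 1 w Ω) (hwV : IsTangentField w V)
    {φ : E n → ℝ} (hφ : ContDiff ℝ 1 φ) (hc : HasCompactSupport φ) (hs : tsupport φ ⊆ Ω) :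
    ∫ x : Ω, φ x • wedge (τ' x) (w x) ∂μ' =
      μ.setIntegral univ fun x : Ω => φ x • (-1 : ℝ) ^ m •
        wedge (k := m + 1) (l := 1) (simpleField u x) (divergence w x) := by
  have hφc : Continuous fun x : Ω => φ x := hφ.continuous.comp continuous_subtype_val
  have hφs := hasCompactSupport_comp_subtype_val hc hs
  have hwc : Continuous fun x : Ω => w x :=
    hw.continuousOn.comp_continuous continuous_subtype_val fun x => x.2
  have hint := integrable_add_measure.1 hμ.1
  have hi' := (locallyIntegrable_wedge hμ'.2.1 hwc).integrable_smul_left_of_hasCompactSupport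
    hφc hφs
  have hi : ∀ ν : Measure Ω, Integrable (fun x : Ω => simpleField u x) ν →
      Integrable (fun x : Ω => φ x • (-1 : ℝ) ^ m •
        wedge (k := m + 1) (l := 1) (simpleField u x) (divergence w x)) ν := fun ν hν =>
    ((locallyIntegrable_wedge hν (continuous_divergence hw)).smul
      ((-1 : ℝ) ^ m)).integrable_smul_left_of_hasCompactSupport hφc hφs
  -- Scalar components are compared: for each `ℓ`, the boundary identity is used with the form `a ↦
  -- ℓ(a ∧ φw)`.
  refine (SeparatingDual.eq_iff_forall_dual_eq (R := ℝ)).2 fun ℓ => ?_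
  have hη := (wedgeCovec ℓ).contDiff.comp (contDiff_smul_of_tsupport_subset hw hφ hs)
  have hsub : Function.support (fun y => wedgeCovec ℓ (φ y • w y)) ⊆ Function.support φ := by
    intro y hy h
    exact hy (by simp [Function.notMem_support.1 (not_not.2 h)])
  have key := integral_pairing_boundary hμ hμ' hη
    (hc.mono hsub) ((closure_mono hsub).trans hs)
  rw [← ℓ.integral_comp_comm hi', SignedRadon.setIntegral, map_sub, Measure.restrict_univ,
    Measure.restrict_univ, ← ℓ.integral_comp_comm (hi _ hint.1),
    ← ℓ.integral_comp_comm (hi _ hint.2)]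
  rw [SignedRadon.setIntegral, Measure.restrict_univ, Measure.restrict_univ] at key
  convert! key using 1
  · refine integral_congr_ae (Filter.Eventually.of_forall fun x => ?_)
    simp only [Function.comp_apply]
    rw [pairing_wedgeCovec, ← wedgeₗ_apply, ← wedgeₗ_apply, map_smul (wedgeₗ n m 2 (τ' x))]
  · have h := fun x : Ω => pairing_extDeriv_wedgeCovec hu huV hw hwV ℓ hφ hs x
    congr 1 <;> exact integral_congr_ae (Filter.Eventually.of_forall fun x => (h x).symm)

end Main

end NormalCurrent

end

/-- Here `k = m + 1` is the dimension of the current, so that `2 ≤ k < n` reads `1 ≤ m` and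
`m + 1 < n`, and the sign `(-1) ^ (k - 1)` is `(-1) ^ m`. The identity of Radon measures with values
in `(k+1)`-vectors is expressed on the Borel subsets of compact subsets of `Ω`. -/
theorem mainTheorem6 (n m : ℕ) (hm : 1 ≤ m) (hmn : m + 1 < n)
    (Ω : Opens (E n)) (V : Ω → Submodule ℝ (E n)) (hV : IsPlaneDistribution (m + 1) V)
    (u : Fin (m + 1) → E n → E n) (hu : ∀ i, ContDiffOn ℝ 1 (u i) Ω) (huV : Spans u V)
    (T : Current Ω (m + 1)) (hT : IsNormal T) (hTV : IsTangentCurrent T V)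
    (μ : SignedRadon Ω) (hμ : IsRepresentedSigned T (fun x => simpleField u x) μ)
    (τ' : Ω → MultiVec n m) (μ' : Measure Ω) (hμ' : IsRepresented (boundary T) τ' μ')
    (w : E n → MultiVec n 2) (hw : ContDiffOn ℝ 1 w Ω) (hwV : IsTangentField w V) :
    ∀ K : Set Ω, IsCompact K → ∀ B ⊆ K, MeasurableSet B →
      IntegrableOn (fun x : Ω => wedge (τ' x) (w x)) B μ' ∧
      IntegrableOn (fun x : Ω => wedge (simpleField u x) (divergence w x)) B μ.variation ∧
      (∫ x in B, wedge (τ' x) (w x) ∂μ' : MultiVec n (m + 2)) =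
        (-1 : ℝ) ^ m • μ.setIntegral B
          (fun x : Ω => wedge (simpleField u x) (divergence w x)) := by
  have hwc : Continuous fun x : Ω => w x :=
    hw.continuousOn.comp_continuous continuous_subtype_val fun x => x.2
  have hf := locallyIntegrable_wedge hμ'.2.1 hwc
  have hg := locallyIntegrable_wedge hμ.1 (continuous_divergence (k := 1) hw)
  have := hμ'.1
  intro K hK B hBK hB
  refine ⟨(locallyIntegrable_iff.1 hf _ hK).mono_set hBK,
    (locallyIntegrable_iff.1 hg _ hK).mono_set hBK, ?_⟩
  refine (setIntegral_eq_of_integral_testFunction_smul μ hf (hg.smul ((-1 : ℝ) ^ m))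
    (fun φ h1 h2 h3 => integral_smul_wedge_boundary hu huV hμ hμ' hw hwV
      (h1.of_le (by exact_mod_cast le_top)) h2 h3) hK hBK hB).trans ?_
  simp only [SignedRadon.setIntegral, Pi.smul_apply, integral_smul, smul_sub]
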